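/- Let $m,n\ge 1$ be integers with $m+n\ge 3$, and let $K_{m,n}$ be the complete bipartite graph with parts of sizes $m$ and $n$. For a finite connected graph $\Gamma$ let $F_\Gamma=\sum_{T}\prod_{e\in E(T)}x_e$ be its Kirchhoff polynomial, where $T$ runs over the spanning trees of $\Gamma$, let $H_\Gamma=\left(\frac{\partial^2 F_\Gamma}{\partial x_i\,\partial x_j}\right)_{i,j\in E(\Gamma)}$, and let $\tilde H_\Gamma$ be the real symmetric matrix obtained from $H_\Gamma$ by setting all $x_e=1$. Then the eigenvalues of $\tilde H_{K_{m,n}}$ are \[ -2m^{n-2}n^{m-2},\qquad -m^{n-2}n^{m-1},\qquad -m^{n-1}n^{m-2},\qquad m^{n-2}n^{m-2}(m+n-1)(m+n-2), \] with multiplicities \[ (m-1)(n-1),\qquad n-1,\qquad m-1,\qquad 1, \] respectively. Here a value listed with multiplicity $0$ contributes nothing, and when several of the listed values coincide their multiplicities are added. In precise terms, writing $\lambda_1,\dots,\lambda_4$ for the values and $d_1,\dots,d_4$ for the multiplicities, the characteristic polynomial of $\tilde H_{K_{m,n}}$ is $\prod_{k=1}^4(t-\lambda_k)^{d_k}$,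 and for every $\mu\in\mathbb R$ the eigenspace $\ker(\tilde H_{K_{m,n}}-\mu I)$ has dimension $\sum_{k:\lambda_k=\mu}d_k$. In particular, the quadratic form of $\tilde H_{K_{m,n}}$ has Lorentzian signature: its positive index of inertia is $1$ and its negative index of inertia is $mn-1$. -/

import Mathlib

noncomputable section

namespace SpanningTreeHessian

instance decidableRelCompleteBipartiteGraphAdj (V W : Type*) :
    DecidableRel (completeBipartiteGraph V W).Adj := fun v w =>
  inferInstanceAs (Decidable (v.isLeft ∧ w.isRight ∨ v.isRight ∧ w.isLeft))

open scoped Classical in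
/-- The set `B_G` of spanning trees of a graph `G`. A spanning tree is given by its set of edges `T`:
the graph on *all* vertices of `G` whose edges are those in `T` has to be a tree. -/
def spanningTrees {V : Type*} (G : SimpleGraph V) [Fintype G.edgeSet] :
    Finset (Finset G.edgeSet) :=
  Finset.univ.filter fun T =>
    (SimpleGraph.fromEdgeSet ((fun e : G.edgeSet => (e : Sym2 V)) '' (T : Set G.edgeSet))).IsTree

/-- The Kirchhoff polynomial `F_G = ∑_T ∏_{e ∈ T} x_e`, with one variable `x_e` for each edge `e`
of `G`, the sum running over the spanning trees `T` of `G`. -/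
def kirchhoffPolynomial {V : Type*} (G : SimpleGraph V) [Fintype G.edgeSet] :
    MvPolynomial G.edgeSet ℝ :=
  ∑ T ∈ spanningTrees G, ∏ e ∈ T, MvPolynomial.X e

/-- The Hessian matrix `H_G = (∂²F_G / ∂x_i ∂x_j)`, indexed by the edges of `G`. -/
def hessianMatrix {V : Type*} (G : SimpleGraph V) [Fintype G.edgeSet] :
    Matrix G.edgeSet G.edgeSet (MvPolynomial G.edgeSet ℝ) :=
  Matrix.of fun i j =>
    MvPolynomial.pderiv i (MvPolynomial.pderiv j (kirchhoffPolynomial G))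

/-- The real matrix `H̃_G`: the value of the Hessian matrix `H_G` at the point where all the
variables are equal to `1`. -/
def hessianAtOne {V : Type*} (G : SimpleGraph V) [Fintype G.edgeSet] :
    Matrix G.edgeSet G.edgeSet ℝ :=
  (hessianMatrix G).map (MvPolynomial.eval fun _ => (1 : ℝ))

end SpanningTreeHessian

end

/-! By the weighted matrix tree theorem the Kirchhoff polynomial is `det (A * diagonal x * Aᵀ)`,
with `A` the incidence matrix less one vertex row. Off the diagonal, an entry of the Hessian at `1`
counts the spanning trees through two given edges. Changing the weights of two edges is a rank-two
update of the Laplacian `L = A * Aᵀ`, so this count is `det L * (K i i * K j j - K i j * K j i)`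
with `K = Aᵀ * L⁻¹ * A`, the transfer current matrix (`hessianAtOne_eq_transfer_current`).

For the complete bipartite graph, `K` has a closed form depending only on which endpoints two edges
share. The Hessian is therefore a combination of `I ⊗ I`, `I ⊗ J`, `J ⊗ I` and `J ⊗ J`, with `J` an
all-ones matrix. These are diagonalized by one orthogonal Kronecker product
(`exists_orthogonal_conj_prod`), and the four eigenvalues correspond to choosing the zero or nonzero
eigenvalue of `J` in each factor. Characteristic polynomial, eigenspaces and signature all follow
from this diagonalization. -/

open Finset Matrix SpanningTreeHessian

/-! ### Cauchy–Binet with weights on the columns. -/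

section CauchyBinet

variable {W E R : Type*} [Fintype W] [DecidableEq W] [Fintype E] [DecidableEq E] [CommRing R]

/-- Each row of the product is a linear combination of the columns of `A`; multilinearity of the
determinant in the rows lets every row `v` choose one column `f v`. -/
theorem det_mul_diagonal_mul_transpose_eq_sum_fun (A : Matrix W E R) (w : E → R) :
    (A * diagonal w * Aᵀ).det =
      ∑ f : W → E, (∏ v, w (f v)) * ((∏ v, A v (f v)) * (A.submatrix id f).det) := by
  have h : (A * diagonal w * Aᵀ : Matrix W W R) =
      fun v => ∑ e, (w e * A v e) • Aᵀ e := by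
    ext v v'
    rw [Finset.sum_apply, Matrix.mul_apply]
    refine Finset.sum_congr rfl fun e _ => ?_
    simp [Matrix.mul_diagonal]
    ring
  have h2 := (detRowAlternating (n := W) (R := R)).toMultilinearMap.map_sum
    (fun v e => (w e * A v e) • Aᵀ e)
  rw [h]
  refine h2.trans (Finset.sum_congr rfl fun f _ => ?_)
  rw [MultilinearMap.map_smul_univ, Finset.prod_mul_distrib, smul_eq_mul, mul_assoc]
  congr 2
  exact det_transpose (A.submatrix id f)

/-- The admissible `g` are exactly the `f ∘ σ`. Permuting the columns by `σ` contributes its sign,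
which turns the sum into one Leibniz expansion times one remaining determinant. -/
theorem sum_image_eq_det_sq (A : Matrix W E R) (f : W → E) (hf : Function.Injective f) :
    ∑ g : W → E with Function.Injective g ∧ univ.image g = univ.image f,
      (∏ v, A v (g v)) * (A.submatrix id g).det = (A.submatrix id f).det ^ 2 := by
  classical
  have key : (A.submatrix id f).det ^ 2 = ∑ σ : Equiv.Perm W,
      (∏ v, A v (f (σ v))) * (A.submatrix id (f ∘ σ)).det := by
    rw [sq]
    conv_lhs => enter [1]; rw [← det_transpose, det_apply']
    rw [Finset.sum_mul]
    refine Finset.sum_congr rfl fun σ _ => ?_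
    have := det_permute' σ (A.submatrix id f)
    rw [submatrix_submatrix] at this
    simp only [Function.comp_id] at this
    rw [this]
    simp only [transpose_apply, submatrix_apply, id]
    ring
  rw [key]
  symm
  refine Finset.sum_bij (fun σ _ => f ∘ σ) ?_ ?_ ?_ ?_
  · intro σ _
    simp only [mem_filter, mem_univ, true_and]
    refine ⟨hf.comp σ.injective, ?_⟩
    rw [← Finset.image_image, Finset.image_univ_equiv]
  · intro σ _ τ _ h
    ext v
    exact hf (congrFun h v)
  · intro g hg
    simp only [mem_filter, mem_univ, true_and] at hg
    obtain ⟨hg1, hg2⟩ := hg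
    have h : ∀ v, ∃ u, f u = g v := fun v => by
      have : g v ∈ univ.image f := hg2 ▸ mem_image_of_mem g (mem_univ v)
      simpa using this
    choose s hs using h
    have hsi : Function.Injective s := fun a b hab => hg1 (by rw [← hs, ← hs, hab])
    exact ⟨Equiv.ofBijective s (Finite.injective_iff_bijective.1 hsi), mem_univ _, funext hs⟩
  · intro σ _
    rfl

/-- A form of the **Cauchy–Binet formula**. -/
theorem det_mul_diagonal_mul_transpose (A : Matrix W E R) (w : E → R) :
    (A * diagonal w * Aᵀ).det = ∑ S : Finset E, (∏ e ∈ S, w e) *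
      ∑ g : W → E with Function.Injective g ∧ univ.image g = S,
        (∏ v, A v (g v)) * (A.submatrix id g).det := by
  rw [det_mul_diagonal_mul_transpose_eq_sum_fun]
  rw [← Finset.sum_filter_of_ne (p := Function.Injective)]
  · rw [← Finset.sum_fiberwise _ (fun f : W → E => univ.image f)]
    refine Finset.sum_congr rfl fun S _ => ?_
    rw [Finset.mul_sum, Finset.filter_filter]
    refine Finset.sum_congr rfl fun g hg => ?_
    simp only [mem_filter, mem_univ, true_and] at hg
    rw [← hg.2, Finset.prod_image fun a _ b _ h => hg.1 h]
  · intro f _ hf a b hab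
    by_contra hne
    apply hf
    rw [det_zero_of_column_eq hne (by simp [hab])]
    simp

end CauchyBinet

/-! ### The weighted matrix tree theorem. -/

section MatrixTree

variable {V W : Type*} {G : SimpleGraph V}

/-- `B` is the signed incidence matrix of an orientation of `G`. -/
def IsSignedIncidence [DecidableEq V] (G : SimpleGraph V) (B : Matrix V G.edgeSet ℤ) : Prop :=
  ∀ e : G.edgeSet, ∃ u v : V, (e : Sym2 V) = s(u, v) ∧
    ∀ x, B x e = (if x = u then 1 else 0) - (if x = v then 1 else 0)

/-- The spanning subgraph whose edges are those in `S`. -/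
def spanningSubgraph (S : Set G.edgeSet) : SimpleGraph V :=
  SimpleGraph.fromEdgeSet ((fun e : G.edgeSet => (e : Sym2 V)) '' S)

theorem mem_spanningTrees [Fintype G.edgeSet] {S : Finset G.edgeSet} :
    S ∈ spanningTrees G ↔ (spanningSubgraph (S : Set G.edgeSet)).IsTree := by
  simp [spanningTrees, spanningSubgraph]

theorem spanningSubgraph_isTree_iff [Fintype V] (S : Finset G.edgeSet) :
    (spanningSubgraph (S : Set G.edgeSet)).IsTree ↔
      (spanningSubgraph (S : Set G.edgeSet)).Connected ∧ S.card + 1 = Fintype.card V := by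
  have hedge : (spanningSubgraph (S : Set G.edgeSet)).edgeSet =
      (fun e : G.edgeSet => (e : Sym2 V)) '' (S : Set G.edgeSet) := by
    rw [spanningSubgraph, SimpleGraph.edgeSet_fromEdgeSet, sdiff_eq_left, Set.disjoint_left]
    rintro _ ⟨e, -, rfl⟩ h
    exact G.not_isDiag_of_mem_edgeSet e.2 h
  rw [SimpleGraph.isTree_iff_connected_and_card, hedge, Nat.card_coe_set_eq,
    Set.ncard_image_of_injective _ Subtype.val_injective, Set.ncard_coe_finset,
    Nat.card_eq_fintype_card]

variable [DecidableEq V] [Fintype W] [DecidableEq W]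

/-- Over `ℤ` a unit determinant means that the columns span. An edge contributes `δ a - δ b`, these
telescope along paths, and `δ r = 0` because the row of the root is missing; connectedness thus puts
every basis vector in the span. -/
theorem isUnit_det_of_connected {B : Matrix V G.edgeSet ℤ} (hB : IsSignedIncidence G B)
    {ι : W → V} (hι : Function.Injective ι) {r : V} (hr : ∀ v, v ∉ Set.range ι ↔ v = r)
    (f : W → G.edgeSet) (hc : (spanningSubgraph (Set.range f)).Connected) :
    IsUnit (B.submatrix ι f).det := by
  rw [← Matrix.isUnit_iff_isUnit_det, ← Matrix.mulVec_surjective_iff_isUnit]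
  let δ : V → W → ℤ := fun x w => if ι w = x then 1 else 0
  let P := LinearMap.range (B.submatrix ι f).mulVecLin
  have hadj : ∀ u v, (spanningSubgraph (Set.range f)).Adj u v → δ u - δ v ∈ P := by
    intro u v huv
    obtain ⟨⟨e, ⟨w, rfl⟩, he⟩, -⟩ := (SimpleGraph.fromEdgeSet_adj _).1 huv
    obtain ⟨a, b, hab, hBe⟩ := hB (f w)
    have hmem : δ a - δ b ∈ P := by
      refine ⟨Pi.single w 1, ?_⟩
      ext x
      simp [δ, hBe]
    have he' : s(a, b) = s(u, v) := hab.symm.trans he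
    rcases Sym2.eq_iff.1 he' with ⟨rfl, rfl⟩ | ⟨rfl, rfl⟩
    · exact hmem
    · simpa using P.neg_mem hmem
  have hreach : ∀ u v, (spanningSubgraph (Set.range f)).Reachable u v → δ u - δ v ∈ P := by
    rintro u v ⟨p⟩
    induction p with
    | nil => simp
    | cons h _ ih => simpa using P.add_mem (hadj _ _ h) ih
  have hroot : δ r = 0 := by
    ext w
    have : ι w ≠ r := fun h => (hr r).2 rfl ⟨w, h⟩
    simp [δ, this]
  have htop : P = ⊤ := by
    rw [eq_top_iff, ← (Pi.basisFun ℤ W).span_eq, Submodule.span_le]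
    rintro _ ⟨w, rfl⟩
    have := hreach (ι w) r (hc.preconnected _ _)
    rw [hroot, sub_zero] at this
    have h : Pi.basisFun ℤ W w = δ (ι w) := by
      ext x
      simp [δ, Pi.single_apply, hι.eq_iff]
    rwa [h]
  exact LinearMap.range_eq_top.1 htop

/-- The indicator `X` of a component avoiding the root is a left null vector: every chosen edge has
both endpoints inside the component or both outside. -/
theorem det_eq_zero_of_not_connected {B : Matrix V G.edgeSet ℤ} (hB : IsSignedIncidence G B)
    {ι : W → V} {r : V} (hr : ∀ v, v ∉ Set.range ι ↔ v = r)
    (hι : Function.Injective ι)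
    (f : W → G.edgeSet) (hc : ¬ (spanningSubgraph (Set.range f)).Connected) :
    (B.submatrix ι f).det = 0 := by
  classical
  have hex : ∃ v, ¬ (spanningSubgraph (Set.range f)).Reachable v r := by
    by_contra! h
    have : Nonempty V := ⟨r⟩
    exact hc ⟨fun u v => (h u).trans (h v).symm⟩
  obtain ⟨v, hv⟩ := hex
  let X : V → ℤ := fun x => if (spanningSubgraph (Set.range f)).Reachable v x then 1 else 0
  -- The missing row does no harm, since `X` vanishes at `r`.
  have hX : ∀ a, ∑ w, X (ι w) * (if ι w = a then 1 else 0) = X a := by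
    intro a
    by_cases ha : a ∈ Set.range ι
    · obtain ⟨w, rfl⟩ := ha
      simp [hι.eq_iff]
    · have h0 : X a = 0 := by rw [(hr a).1 ha]; simp [X, hv]
      rw [h0]
      refine Finset.sum_eq_zero fun w _ => ?_
      rw [if_neg fun h => ha ⟨w, h⟩, mul_zero]
  rw [← Matrix.exists_vecMul_eq_zero_iff]
  refine ⟨fun w => X (ι w), ?_, ?_⟩
  · have hvr : v ∈ Set.range ι := by
      by_contra h
      exact hv ((hr v).1 h ▸ SimpleGraph.Reachable.refl _)
    obtain ⟨w, rfl⟩ := hvr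
    intro h
    have := congrFun h w
    simp [X] at this
  · ext w
    obtain ⟨a, b, hab, hBe⟩ := hB (f w)
    simp only [Matrix.vecMul, dotProduct, submatrix_apply, hBe, mul_sub, Finset.sum_sub_distrib, hX,
      Pi.zero_apply]
    have hne : a ≠ b := by
      have := (f w).2
      rw [hab, SimpleGraph.mem_edgeSet] at this
      exact this.ne
    have hadj : (spanningSubgraph (Set.range f)).Adj a b :=
      (SimpleGraph.fromEdgeSet_adj _).2 ⟨⟨f w, ⟨w, rfl⟩, hab⟩, hne⟩
    have hiff : (spanningSubgraph (Set.range f)).Reachable v a ↔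
        (spanningSubgraph (Set.range f)).Reachable v b :=
      ⟨fun h => h.trans hadj.reachable, fun h => h.trans hadj.reachable.symm⟩
    simp [X, hiff]

/-- The weighted **matrix tree theorem**. -/
theorem sum_spanningTrees_eq_det [Fintype V] [Fintype G.edgeSet] {B : Matrix V G.edgeSet ℤ} (hB : IsSignedIncidence G B)
    {ι : W → V} (hι : Function.Injective ι) {r : V} (hr : ∀ v, v ∉ Set.range ι ↔ v = r)
    (A : Matrix W G.edgeSet ℝ) (hA : A = (B.submatrix ι id).map (Int.castRingHom ℝ))
    (w : G.edgeSet → ℝ) :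
    ∑ T ∈ spanningTrees G, ∏ e ∈ T, w e = (A * diagonal w * Aᵀ).det := by
  classical
  have hdet : ∀ f : W → G.edgeSet,
      (A.submatrix id f).det = ((B.submatrix ι f).det : ℝ) := by
    intro f
    have := RingHom.map_det (Int.castRingHom ℝ) (B.submatrix ι f)
    rw [eq_intCast] at this
    rw [this, hA]
    rfl
  have hcard : Fintype.card V = Fintype.card W + 1 := by
    have h1 : univ.image ι = univ.erase r := by
      ext v
      have := hr v
      simp only [mem_image, mem_univ, true_and, mem_erase, and_true, Set.mem_range] at this ⊢
      tauto
    have h2 := congrArg Finset.card h1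
    rw [Finset.card_image_of_injective _ hι, Finset.card_erase_of_mem (mem_univ r)] at h2
    have h3 : 0 < Fintype.card V := Fintype.card_pos_iff.2 ⟨r⟩
    simp only [Finset.card_univ] at h2
    omega
  rw [det_mul_diagonal_mul_transpose, ← Finset.sum_subset (Finset.subset_univ (spanningTrees G))]
  · refine Finset.sum_congr rfl fun S hS => ?_
    rw [mem_spanningTrees] at hS
    have hS' := (spanningSubgraph_isTree_iff S).1 hS
    have hSc : Fintype.card W = Fintype.card S := by
      rw [Fintype.card_coe]; omega
    -- An arbitrary enumeration of the tree edges by the non-root vertices; the squared minor does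
    -- not depend on it.
    let f : W → G.edgeSet := fun x => (Fintype.equivOfCardEq hSc x : G.edgeSet)
    have hf : Function.Injective f :=
      Subtype.val_injective.comp (Fintype.equivOfCardEq hSc).injective
    have hfS : univ.image f = S := by
      apply Finset.eq_of_subset_of_card_le
      · intro x hx
        simp only [mem_image, mem_univ, true_and] at hx
        obtain ⟨a, rfl⟩ := hx
        exact (Fintype.equivOfCardEq hSc a).2
      · rw [Finset.card_image_of_injective _ hf, Finset.card_univ, hSc, Fintype.card_coe]
    have hrange : (S : Set G.edgeSet) = Set.range f := by
      rw [← hfS]; simp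
    have hu := isUnit_det_of_connected hB hι hr f (hrange ▸ hS'.1)
    conv_rhs => enter [2]; rw [← hfS]
    rw [sum_image_eq_det_sq A f hf, hdet]
    rcases Int.isUnit_iff.1 hu with h | h <;> simp [h]
  -- A set that is not a tree either has the wrong size, so that no `g` enumerates it, or is
  -- disconnected, so that its minors vanish.
  · intro S _ hS
    rw [Finset.sum_eq_zero, mul_zero]
    intro f hf
    simp only [mem_filter, mem_univ, true_and] at hf
    have hrange : (S : Set G.edgeSet) = Set.range f := by
      rw [← hf.2]; simp
    rw [mem_spanningTrees, spanningSubgraph_isTree_iff] at hS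
    have hSc : S.card = Fintype.card W := by
      rw [← hf.2, Finset.card_image_of_injective _ hf.1, Finset.card_univ]
    have hnc : ¬ (spanningSubgraph (Set.range f)).Connected := by
      intro h
      exact hS ⟨hrange ▸ h, by omega⟩
    rw [hdet, det_eq_zero_of_not_connected hB hr hι f hnc]
    simp

end MatrixTree

/-! ### Hessian entries through transfer currents. -/

section Hessian

variable {V W : Type*} {G : SimpleGraph V} [Fintype G.edgeSet]

theorem eval_pderiv_pderiv_prod_X {σ : Type*} [DecidableEq σ] (T : Finset σ) (i j : σ) :
    MvPolynomial.eval (fun _ => (1 : ℝ)) (MvPolynomial.pderiv i (MvPolynomial.pderiv j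
      (∏ e ∈ T, MvPolynomial.X e))) = if i ≠ j ∧ i ∈ T ∧ j ∈ T then 1 else 0 := by
  have h : (∏ e ∈ T, MvPolynomial.X e : MvPolynomial σ ℝ) =
      MvPolynomial.monomial (∑ e ∈ T, Finsupp.single e 1) 1 := by
    simp [MvPolynomial.X, MvPolynomial.monomial_sum_one]
  have hs : ∀ x, (∑ e ∈ T, Finsupp.single e 1 : σ →₀ ℕ) x = if x ∈ T then 1 else 0 := by
    intro x
    simp [Finsupp.finsetSum_apply, Finsupp.single_apply]
  rw [h, MvPolynomial.pderiv_monomial, MvPolynomial.pderiv_monomial, MvPolynomial.eval_monomial]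
  simp only [Finsupp.tsub_apply, hs, Finsupp.single_apply]
  by_cases hij : i = j
  · subst hij
    by_cases hi : i ∈ T <;> simp [hi]
  · by_cases hi : i ∈ T <;> by_cases hj : j ∈ T <;> simp [hi, hj, hij, Ne.symm hij]

theorem hessianAtOne_apply [DecidableEq V] (i j : G.edgeSet) :
    hessianAtOne G i j = ∑ T ∈ spanningTrees G, if i ≠ j ∧ i ∈ T ∧ j ∈ T then 1 else 0 := by
  simp only [hessianAtOne, hessianMatrix, kirchhoffPolynomial, Matrix.map_apply, Matrix.of_apply,
    map_sum, eval_pderiv_pderiv_prod_X]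

/-- The coefficient of `s * t` is the indicator of `T` containing both edges, so a mixed difference
in `s` and `t` isolates the trees counted by the Hessian. -/
theorem prod_one_add_add {σ : Type*} [DecidableEq σ] (T : Finset σ) {i j : σ} (hij : i ≠ j)
    (s t : ℝ) :
    ∏ e ∈ T, (1 + s * (if e = i then 1 else 0) + t * (if e = j then 1 else 0)) =
      (1 + s * (if i ∈ T then 1 else 0)) * (1 + t * (if j ∈ T then 1 else 0)) := by
  have h : ∀ e ∈ T, 1 + s * (if e = i then 1 else 0) + t * (if e = j then 1 else 0) =
      (if e = i then 1 + s else 1) * (if e = j then 1 + t else 1) := by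
    intro e _
    by_cases h1 : e = i
    · subst h1; simp [hij]
    · by_cases h2 : e = j <;> simp [h1, h2, hij.symm]
  rw [Finset.prod_congr rfl h, Finset.prod_mul_distrib, Finset.prod_ite_eq', Finset.prod_ite_eq']
  split_ifs <;> simp

variable [Fintype V] [DecidableEq V] [Fintype W] [DecidableEq W]

/-- The entries of the Hessian of the Kirchhoff polynomial in terms of the transfer current matrix
`Aᵀ * Φ`, where `Φ` collects the potentials of unit currents through the edges. -/
theorem hessianAtOne_eq_transfer_current {B : Matrix V G.edgeSet ℤ} (hB : IsSignedIncidence G B)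
    {ι : W → V} (hι : Function.Injective ι) {r : V} (hr : ∀ v, v ∉ Set.range ι ↔ v = r)
    (A : Matrix W G.edgeSet ℝ) (hA : A = (B.submatrix ι id).map (Int.castRingHom ℝ))
    (hdet : (A * Aᵀ).det ≠ 0) (Φ : Matrix W G.edgeSet ℝ) (hΦ : A * Aᵀ * Φ = A)
    (i j : G.edgeSet) :
    hessianAtOne G i j = (A * Aᵀ).det *
      ((Aᵀ * Φ) i i * (Aᵀ * Φ) j j - (Aᵀ * Φ) i j * (Aᵀ * Φ) j i) := by
  rw [hessianAtOne_apply]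
  by_cases hij : i = j
  · subst hij; simp
  -- The weighted tree sum with edge `i` of weight `1 + s` and edge `j` of weight `1 + t`.
  let Z : ℝ → ℝ → ℝ := fun s t => ∑ T ∈ spanningTrees G,
    ∏ e ∈ T, (1 + s * (if e = i then 1 else 0) + t * (if e = j then 1 else 0))
  have hu : IsUnit (A * Aᵀ).det := isUnit_iff_ne_zero.2 hdet
  have hinv : (A * Aᵀ)⁻¹ * A = Φ := by
    have := congrArg ((A * Aᵀ)⁻¹ * ·) hΦ
    simp only [Matrix.nonsing_inv_mul_cancel_left _ _ hu] at this
    exact this.symm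
  have hZ : ∀ s t, Z s t = (A * Aᵀ).det * ((1 + s * (Aᵀ * Φ) i i) * (1 + t * (Aᵀ * Φ) j j) -
      s * t * ((Aᵀ * Φ) i j * (Aᵀ * Φ) j i)) := by
    intro s t
    have h1 : Z s t = _ := sum_spanningTrees_eq_det hB hι hr A hA _
    rw [h1]
    -- The reweighting perturbs the Laplacian by rank at most two, so the determinant lemma leaves a
    -- `2 × 2` determinant.
    let U : Matrix W (Fin 2) ℝ := (A.submatrix id ![i, j]) * diagonal ![s, t]
    have h2 : A * diagonal (fun e => 1 + s * (if e = i then 1 else 0) +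
        t * (if e = j then 1 else 0)) * Aᵀ = A * Aᵀ + U * Aᵀ.submatrix ![i, j] id := by
      ext a b
      rw [Matrix.add_apply, Matrix.mul_apply, Matrix.mul_apply, Matrix.mul_apply]
      simp only [U, Matrix.mul_diagonal, Fin.sum_univ_two, submatrix_apply, transpose_apply,
        mul_add, add_mul, Finset.sum_add_distrib, id, mul_ite, ite_mul, mul_one, mul_zero,
        zero_mul, Finset.sum_ite_eq', mem_univ, if_true, cons_val_zero, cons_val_one]
      ring
    rw [h2, det_add_mul _ _ hu]
    have h3 : Aᵀ.submatrix ![i, j] id * (A * Aᵀ)⁻¹ * U =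
        (Aᵀ * Φ).submatrix ![i, j] ![i, j] * diagonal ![s, t] := by
      simp only [U]
      rw [← Matrix.mul_assoc, Matrix.mul_assoc _ _ (A.submatrix _ _)]
      congr 1
      rw [← hinv]
      rfl
    rw [h3, det_fin_two]
    simp only [Matrix.add_apply, Matrix.mul_diagonal, submatrix_apply, Matrix.one_apply_eq,
      cons_val_zero, cons_val_one, Matrix.one_apply_ne (zero_ne_one' (Fin 2)),
      Matrix.one_apply_ne (one_ne_zero' (Fin 2))]
    ring
  have hmix : Z 1 1 - Z 1 0 - Z 0 1 + Z 0 0 =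
      ∑ T ∈ spanningTrees G, if i ≠ j ∧ i ∈ T ∧ j ∈ T then (1 : ℝ) else 0 := by
    simp only [Z, prod_one_add_add _ hij]
    rw [← Finset.sum_sub_distrib, ← Finset.sum_sub_distrib, ← Finset.sum_add_distrib]
    refine Finset.sum_congr rfl fun T _ => ?_
    by_cases hi : i ∈ T <;> by_cases hj : j ∈ T <;> norm_num [hi, hj, hij]
  rw [← hmix, hZ, hZ, hZ, hZ]
  ring

end Hessian

/-! ### Tree count and transfer currents of the complete bipartite graph. -/

section CompleteBipartite

/-- The edges of the complete bipartite graph correspond to the pairs of vertices of the two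
parts. -/
noncomputable def completeBipartiteEdgeEquiv (α β : Type*) :
    α × β ≃ (completeBipartiteGraph α β).edgeSet :=
  Equiv.ofBijective (fun p => ⟨s(Sum.inl p.1, Sum.inr p.2), by simp⟩) <| by
    constructor
    · rintro ⟨a, b⟩ ⟨a', b'⟩ h
      simpa using h
    · rintro ⟨e, he⟩
      induction e with
      | _ x y =>
        rw [SimpleGraph.mem_edgeSet] at he
        rcases x with a | b <;> rcases y with a' | b' <;> simp at he
        · exact ⟨(a, b'), rfl⟩
        · exact ⟨(a', b), Subtype.ext Sym2.eq_swap⟩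

/-- The incidence matrix of the complete bipartite graph with all edges oriented from right to
left. -/
noncomputable def completeBipartiteIncidence (α β : Type*) [DecidableEq α] [DecidableEq β] :
    Matrix (α ⊕ β) (completeBipartiteGraph α β).edgeSet ℤ := fun x e =>
  (if x = Sum.inl ((completeBipartiteEdgeEquiv α β).symm e).1 then 1 else 0) -
    (if x = Sum.inr ((completeBipartiteEdgeEquiv α β).symm e).2 then 1 else 0)

theorem isSignedIncidence_completeBipartiteIncidence (α β : Type*) [DecidableEq α]
    [DecidableEq β] :
    IsSignedIncidence (completeBipartiteGraph α β) (completeBipartiteIncidence α β) := by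
  intro e
  obtain ⟨p, rfl⟩ := (completeBipartiteEdgeEquiv α β).surjective e
  exact ⟨Sum.inl p.1, Sum.inr p.2, rfl, fun x => by simp [completeBipartiteIncidence]⟩

variable (m n : ℕ)

/-- The incidence matrix of `K_{m,n+1}` with the row of one vertex removed. -/
noncomputable def reducedIncidence : Matrix (Fin m ⊕ Fin n) (Fin m × Fin (n + 1)) ℝ :=
  fromRows (of fun a p => if a = p.1 then 1 else 0)
    (of fun b p => if b.succ = p.2 then -1 else 0)

theorem reducedIncidence_mul_transpose :
    reducedIncidence m n * (reducedIncidence m n)ᵀ =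
      fromBlocks (diagonal fun _ => (n + 1 : ℝ)) (of fun _ _ => -1) (of fun _ _ => -1)
        (diagonal fun _ => (m : ℝ)) := by
  ext (a | b) (a' | b')
  · by_cases h : a = a'
    · subst h
      simp [reducedIncidence, Matrix.mul_apply, Fintype.sum_prod_type]
    · simp [reducedIncidence, Matrix.mul_apply, Fintype.sum_prod_type, h]
  · simp [reducedIncidence, Matrix.mul_apply, Fintype.sum_prod_type]
  · simp [reducedIncidence, Matrix.mul_apply, Fintype.sum_prod_type]
  · by_cases h : b = b'
    · subst h
      simp [reducedIncidence, Matrix.mul_apply, Fintype.sum_prod_type]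
    · simp [reducedIncidence, Matrix.mul_apply, Fintype.sum_prod_type, h]

/-- The number of spanning trees of `K_{m,n+1}` as a determinant. -/
theorem det_reducedIncidence_mul_transpose (hm : 1 ≤ m) :
    (reducedIncidence m n * (reducedIncidence m n)ᵀ).det =
      (m : ℝ) ^ n * (n + 1 : ℝ) ^ (m - 1) := by
  have hm0 : (m : ℝ) ≠ 0 := by positivity
  have hn0 : (n + 1 : ℝ) ≠ 0 := by positivity
  let c : ℝ := (n + 1 : ℝ)
  let inst : Invertible (diagonal fun _ : Fin m => c) :=
    ⟨diagonal fun _ => c⁻¹, by simp [diagonal_mul_diagonal, c, hn0],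
      by simp [diagonal_mul_diagonal, c, hn0]⟩
  rw [reducedIncidence_mul_transpose]
  change (fromBlocks (diagonal fun _ => c) _ _ _).det = _
  rw [det_fromBlocks₁₁]
  -- The Schur complement of the left block is a scalar multiple of a rank-one perturbation of the
  -- identity.
  have h : (diagonal fun _ : Fin n => (m : ℝ)) - (of fun _ _ => -1 : Matrix (Fin n) (Fin m) ℝ) *
      (⅟ (diagonal fun _ : Fin m => c)) * (of fun _ _ => -1 : Matrix (Fin m) (Fin n) ℝ) =
      (m : ℝ) • (1 + replicateCol Unit (fun _ : Fin n => -c⁻¹) *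
        replicateRow Unit (fun _ : Fin n => (1 : ℝ))) := by
    have hinv : ⅟ (diagonal fun _ : Fin m => c) = diagonal fun _ => c⁻¹ := rfl
    rw [hinv]
    ext a b
    simp only [Matrix.sub_apply, Matrix.mul_apply, Matrix.smul_apply, Matrix.add_apply,
      Matrix.one_apply, diagonal_apply]
    simp
    split_ifs <;> ring
  rw [h, det_smul, det_one_add_replicateCol_mul_replicateRow, det_diagonal]
  obtain ⟨k, rfl⟩ : ∃ k, m = k + 1 := ⟨m - 1, by omega⟩
  simp [dotProduct, c]
  field_simp
  ring

/-- The potentials, relative to the removed vertex, of unit currents through the edges. -/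
noncomputable def edgePotential : Matrix (Fin m ⊕ Fin n) (Fin m × Fin (n + 1)) ℝ :=
  fromRows (of fun a p => (if a = p.1 then 1 else 0) / (n + 1 : ℝ) -
      (1 / (n + 1 : ℝ) - (if p.2 = 0 then 1 else 0)) / m)
    (of fun b p => (1 / (n + 1 : ℝ) - (if p.2 = b.succ then 1 else 0)) / m -
      (1 / (n + 1 : ℝ) - (if p.2 = 0 then 1 else 0)) / m)

/-- The transfer current matrix of `K_{m,n}`. -/
noncomputable def transferCurrent (m n : ℕ) (p q : Fin m × Fin n) : ℝ :=
  (if p.1 = q.1 then 1 else 0) / (n : ℝ) + (if p.2 = q.2 then 1 else 0) / (m : ℝ) -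
    1 / ((m : ℝ) * n)

/-- Currents are potential differences. The term normalizing the removed vertex to potential zero is
common to all vertices and cancels. -/
theorem transpose_mul_edgePotential (p q : Fin m × Fin (n + 1)) :
    ((reducedIncidence m n)ᵀ * edgePotential m n) p q = transferCurrent m (n + 1) p q := by
  obtain ⟨a, b⟩ := p
  rw [Matrix.mul_apply]
  simp only [reducedIncidence, edgePotential, transferCurrent, Fintype.sum_sum_type,
    transpose_apply, fromRows_apply_inl, fromRows_apply_inr, of_apply, ite_mul, one_mul, zero_mul,
    Finset.sum_ite_eq', mem_univ, if_true, eq_comm (a := b)]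
  push_cast
  induction b using Fin.cases with
  | zero =>
    simp [Fin.succ_ne_zero]
    split_ifs <;> ring
  | succ b =>
    simp [eq_comm (a := q.2)]
    split_ifs <;> ring

/-- Kirchhoff's current law: the transfer currents summed at a vertex return the incidence of the
source edge. This certifies the explicit potentials as `L⁻¹ * A` without inverting the Laplacian. -/
theorem laplacian_mul_edgePotential (hm : 1 ≤ m) :
    reducedIncidence m n * (reducedIncidence m n)ᵀ * edgePotential m n =
      reducedIncidence m n := by
  have hm0 : (m : ℝ) ≠ 0 := by positivity
  have hn0 : (n + 1 : ℝ) ≠ 0 := by positivity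
  rw [Matrix.mul_assoc]
  ext (a | b) q
  · rw [Matrix.mul_apply]
    simp only [transpose_mul_edgePotential]
    simp only [reducedIncidence, transferCurrent, fromRows_apply_inl, of_apply, Fintype.sum_prod_type]
    simp [Finset.sum_add_distrib, ← Finset.sum_div]
    field_simp
    split_ifs <;> simp
  · rw [Matrix.mul_apply]
    simp only [transpose_mul_edgePotential]
    simp only [reducedIncidence, transferCurrent, fromRows_apply_inr, of_apply, Fintype.sum_prod_type]
    simp [Finset.sum_add_distrib, ← Finset.sum_div]
    field_simp
    split_ifs
    · simp; ring
    · simp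

theorem hessianAtOne_completeBipartite_succ (hm : 1 ≤ m) (p q : Fin m × Fin (n + 1)) :
    hessianAtOne (completeBipartiteGraph (Fin m) (Fin (n + 1)))
      (completeBipartiteEdgeEquiv _ _ p) (completeBipartiteEdgeEquiv _ _ q) =
      (m : ℝ) ^ n * (n + 1 : ℝ) ^ (m - 1) *
        (transferCurrent m (n + 1) p p * transferCurrent m (n + 1) q q -
          transferCurrent m (n + 1) p q * transferCurrent m (n + 1) q p) := by
  let e := completeBipartiteEdgeEquiv (Fin m) (Fin (n + 1))
  let A := (reducedIncidence m n).submatrix id e.symm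
  let Φ := (edgePotential m n).submatrix id e.symm
  have hAA : A * Aᵀ = reducedIncidence m n * (reducedIncidence m n)ᵀ := by
    simp only [A, transpose_submatrix, submatrix_mul_equiv, submatrix_id_id]
  have hdet : (A * Aᵀ).det = (m : ℝ) ^ n * (n + 1 : ℝ) ^ (m - 1) := by
    rw [hAA, det_reducedIncidence_mul_transpose m n hm]
  have hne : (A * Aᵀ).det ≠ 0 := by
    rw [hdet]; positivity
  have hΦ : A * Aᵀ * Φ = A := by
    rw [hAA]
    conv_rhs => simp only [A]; rw [← laplacian_mul_edgePotential m n hm]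
    rfl
  have hK : ∀ x y, (Aᵀ * Φ) (e x) (e y) = transferCurrent m (n + 1) x y := by
    intro x y
    rw [← transpose_mul_edgePotential]
    simp [A, Φ, Matrix.mul_apply]
  have key := hessianAtOne_eq_transfer_current
    (isSignedIncidence_completeBipartiteIncidence (Fin m) (Fin (n + 1)))
    -- The deleted vertex is `0` on the right; the other right vertices are successors.
    (ι := Sum.map id Fin.succ) (Function.injective_id.sumMap (Fin.succ_injective n))
    (r := Sum.inr 0) (by
      rintro (a | b)
      · simp
      · induction b using Fin.cases <;> simp [Fin.succ_ne_zero])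
    A (by
      ext (a | b) x
      · simp [A, reducedIncidence, completeBipartiteIncidence, e]
      · simp [A, reducedIncidence, completeBipartiteIncidence, e]
        split_ifs <;> simp) hne Φ hΦ (e p) (e q)
  rw [key, hdet, hK, hK, hK, hK]

theorem hessianAtOne_completeBipartite (hm : 1 ≤ m) (hn : 1 ≤ n) (p q : Fin m × Fin n) :
    hessianAtOne (completeBipartiteGraph (Fin m) (Fin n))
      (completeBipartiteEdgeEquiv _ _ p) (completeBipartiteEdgeEquiv _ _ q) =
      (m : ℝ) ^ (n - 1) * (n : ℝ) ^ (m - 1) *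
        (transferCurrent m n p p * transferCurrent m n q q -
          transferCurrent m n p q * transferCurrent m n q p) := by
  obtain ⟨k, rfl⟩ : ∃ k, n = k + 1 := ⟨n - 1, by omega⟩
  rw [hessianAtOne_completeBipartite_succ m k hm]
  simp

end CompleteBipartite

/-! ### What an orthogonal diagonalization determines. -/

section OrthogonalDiagonalization

variable {ι : Type*} [Fintype ι] [DecidableEq ι] {H U : Matrix ι ι ℝ} {d : ι → ℝ}

theorem charpoly_of_orthogonal_conj (hU : U * Uᵀ = 1) (hH : H = U * diagonal d * Uᵀ) :
    H.charpoly = ∏ i, (Polynomial.X - Polynomial.C (d i)) := by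
  rw [hH, charpoly_mul_comm, ← Matrix.mul_assoc, mul_eq_one_comm.1 hU, Matrix.one_mul,
    charpoly_diagonal]

/-- `H - μ` is conjugate to `diagonal (d - μ)`, whose rank counts the `i` with `d i ≠ μ`;
rank–nullity gives the rest. -/
theorem finrank_eigenspace_of_orthogonal_conj (hU : U * Uᵀ = 1) (hH : H = U * diagonal d * Uᵀ)
    (μ : ℝ) :
    Module.finrank ℝ (Module.End.eigenspace (Matrix.toLin' H) μ) =
      Fintype.card {i // d i = μ} := by
  have hU' : Uᵀ * U = 1 := mul_eq_one_comm.1 hU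
  have h1 : Matrix.toLin' H - μ • 1 =
      (U * diagonal (fun i => d i - μ) * Uᵀ).mulVecLin := by
    have : U * diagonal (fun i => d i - μ) * Uᵀ = H - μ • (1 : Matrix ι ι ℝ) := by
      have h2 : diagonal (fun i => d i - μ) = diagonal d - μ • (1 : Matrix ι ι ℝ) := by
        ext i j
        by_cases h : i = j <;> simp [h]
      rw [h2, Matrix.mul_sub, Matrix.sub_mul, ← hH, Matrix.mul_smul, Matrix.smul_mul,
        Matrix.mul_one, hU]
    rw [this, ← Matrix.toLin'_apply', map_sub, map_smul, Matrix.toLin'_one]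
    rfl
  have hrank : (U * diagonal (fun i => d i - μ) * Uᵀ).rank =
      Fintype.card {i // d i ≠ μ} := by
    rw [rank_mul_eq_left_of_isUnit_det _ _
        ((Matrix.isUnit_iff_isUnit_det _).1 (IsUnit.of_mul_eq_one _ hU')),
      rank_mul_eq_right_of_isUnit_det _ _
        ((Matrix.isUnit_iff_isUnit_det _).1 (IsUnit.of_mul_eq_one _ hU)), rank_diagonal]
    exact Fintype.card_congr (Equiv.subtypeEquivRight fun i => sub_ne_zero)
  rw [Module.End.eigenspace_def, h1]
  have h3 := LinearMap.finrank_range_add_finrank_ker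
    (U * diagonal (fun i => d i - μ) * Uᵀ).mulVecLin
  change (U * diagonal (fun i => d i - μ) * Uᵀ).rank + _ = _ at h3
  rw [hrank, Module.finrank_fintype_fun_eq_card] at h3
  have h4 := Fintype.card_subtype_compl (fun i => d i = μ)
  have h5 := Fintype.card_subtype_le (fun i => d i = μ)
  simp only [← ne_eq] at h4
  omega

/-- The substitution `x ↦ Uᵀ x` makes the conjugation a congruence, so the signs of `d` give the
signature. -/
theorem equivalent_weightedSumSquares_of_orthogonal_conj (hU : U * Uᵀ = 1)
    (hH : H = U * diagonal d * Uᵀ) :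
    (Matrix.toQuadraticForm' H).Equivalent (QuadraticMap.weightedSumSquares ℝ d) := by
  refine ⟨⟨Matrix.toLin'OfInv hU (mul_eq_one_comm.1 hU), fun x => ?_⟩⟩
  change QuadraticMap.weightedSumSquares ℝ d (Uᵀ *ᵥ x) = Matrix.toLinearMap₂' ℝ H x x
  rw [toLinearMap₂'_apply', hH, ← Matrix.mulVec_mulVec, ← Matrix.mulVec_mulVec,
    Matrix.dotProduct_mulVec, ← Matrix.mulVec_transpose, QuadraticMap.weightedSumSquares_apply]
  simp only [dotProduct, mulVec_diagonal, smul_eq_mul]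
  exact Finset.sum_congr rfl fun i _ => by ring

end OrthogonalDiagonalization

/-- `J * J = m • J` forces every eigenvalue to be `0` or `m`, and trace `m` forces exactly one to be
`m`. -/
theorem exists_orthogonal_conj_ones (m : ℕ) (hm : 1 ≤ m) :
    ∃ (U : Matrix (Fin m) (Fin m) ℝ) (i₀ : Fin m), U * Uᵀ = 1 ∧
      (Matrix.of fun _ _ => (1 : ℝ)) =
        U * diagonal (fun i => if i = i₀ then (m : ℝ) else 0) * Uᵀ := by
  let J : Matrix (Fin m) (Fin m) ℝ := Matrix.of fun _ _ => 1
  have hJ : J.IsHermitian := by ext; simp [J]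
  let U : Matrix (Fin m) (Fin m) ℝ := hJ.eigenvectorUnitary
  have hU : U * Uᵀ = 1 := by
    have := (Matrix.mem_unitaryGroup_iff).1 hJ.eigenvectorUnitary.2
    rwa [star_eq_conjTranspose, conjTranspose_eq_transpose_of_trivial] at this
  have hU' : Uᵀ * U = 1 := mul_eq_one_comm.1 hU
  have hspec : J = U * diagonal hJ.eigenvalues * Uᵀ := by
    conv_lhs => rw [hJ.spectral_theorem, Unitary.conjStarAlgAut_apply]
    rw [star_eq_conjTranspose, conjTranspose_eq_transpose_of_trivial]
    rfl
  have hdiag : diagonal hJ.eigenvalues = Uᵀ * J * U := by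
    conv_rhs => rw [hspec]
    simp only [Matrix.mul_assoc, hU', Matrix.mul_one]
    rw [← Matrix.mul_assoc, hU', Matrix.one_mul]
  have hsq : ∀ i, hJ.eigenvalues i * hJ.eigenvalues i = m * hJ.eigenvalues i := by
    have hJJ : J * J = (m : ℝ) • J := by
      ext a b
      simp [J, Matrix.mul_apply]
    have h : diagonal hJ.eigenvalues * diagonal hJ.eigenvalues =
        (m : ℝ) • diagonal hJ.eigenvalues := by
      rw [hdiag, ← Matrix.smul_mul, ← Matrix.mul_smul, ← hJJ]
      simp only [Matrix.mul_assoc]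
      rw [← Matrix.mul_assoc U, hU, Matrix.one_mul]
    intro i
    have := congrFun (congrFun h i) i
    simpa using this
  have hval : ∀ i, hJ.eigenvalues i = 0 ∨ hJ.eigenvalues i = m := by
    intro i
    by_cases h : hJ.eigenvalues i = 0
    · exact Or.inl h
    · exact Or.inr (mul_right_cancel₀ h (hsq i))
  have hm0 : (m : ℝ) ≠ 0 := by positivity
  have htr : ∑ i, hJ.eigenvalues i = m := by
    have := hJ.trace_eq_sum_eigenvalues
    simp only [Matrix.trace, J, diag_apply, of_apply, sum_const, card_univ, Fintype.card_fin,
      nsmul_eq_mul, mul_one] at this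
    exact this.symm
  have hcard : ({i | hJ.eigenvalues i = m} : Finset (Fin m)).card = 1 := by
    have h1 : ∑ i, hJ.eigenvalues i = ∑ i, if hJ.eigenvalues i = m then (m : ℝ) else 0 := by
      refine Finset.sum_congr rfl fun i _ => ?_
      rcases hval i with h | h
      · rw [h, if_neg hm0.symm]
      · rw [if_pos h, h]
    rw [htr, ← Finset.sum_filter, Finset.sum_const, nsmul_eq_mul] at h1
    have h2 := mul_right_cancel₀ hm0 ((one_mul _).trans h1)
    exact_mod_cast h2.symm
  obtain ⟨i₀, hi₀⟩ := Finset.card_eq_one.1 hcard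
  refine ⟨U, i₀, hU, ?_⟩
  have : hJ.eigenvalues = fun i => if i = i₀ then (m : ℝ) else 0 := by
    ext i
    have h : hJ.eigenvalues i = m ↔ i = i₀ := by
      have := Finset.ext_iff.1 hi₀ i
      simpa using this
    by_cases hi : i = i₀
    · rw [if_pos hi, h.2 hi]
    · rw [if_neg hi]
      exact (hval i).resolve_right (mt h.1 hi)
  rw [← this]
  exact hspec

/-! ### Simultaneous diagonalization on the product. -/

section Kronecker

open scoped Kronecker

/-- Simultaneous diagonalization of the matrices on a product that are constant on the classes of
pairs of index pairs with the same coincidences. -/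
theorem exists_orthogonal_conj_prod (m n : ℕ) (hm : 1 ≤ m) (hn : 1 ≤ n) :
    ∃ (U : Matrix (Fin m × Fin n) (Fin m × Fin n) ℝ) (i₀ : Fin m) (j₀ : Fin n), U * Uᵀ = 1 ∧
      ∀ c₀ c₁ c₂ c₃ : ℝ,
        (Matrix.of fun p q : Fin m × Fin n => c₀ * (if p = q then 1 else 0) +
          c₁ * (if p.1 = q.1 then 1 else 0) + c₂ * (if p.2 = q.2 then 1 else 0) + c₃) =
        U * diagonal (fun p => c₀ + c₁ * (if p.2 = j₀ then (n : ℝ) else 0) +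
          c₂ * (if p.1 = i₀ then (m : ℝ) else 0) +
          c₃ * ((if p.1 = i₀ then (m : ℝ) else 0) * (if p.2 = j₀ then (n : ℝ) else 0))) * Uᵀ := by
  obtain ⟨U, i₀, hU, hJU⟩ := exists_orthogonal_conj_ones m hm
  obtain ⟨V, j₀, hV, hJV⟩ := exists_orthogonal_conj_ones n hn
  set e : Fin m → ℝ := fun i => if i = i₀ then (m : ℝ) else 0
  set f : Fin n → ℝ := fun j => if j = j₀ then (n : ℝ) else 0
  have hT : (U ⊗ₖ V)ᵀ = Uᵀ ⊗ₖ Vᵀ := kroneckerMap_transpose _ _ _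
  have hc : ∀ a b, (U ⊗ₖ V) * (diagonal a ⊗ₖ diagonal b) * (U ⊗ₖ V)ᵀ =
      (U * diagonal a * Uᵀ) ⊗ₖ (V * diagonal b * Vᵀ) := by
    intro a b
    rw [hT, mul_kronecker_mul, mul_kronecker_mul]
  refine ⟨U ⊗ₖ V, i₀, j₀, ?_, fun c₀ c₁ c₂ c₃ => ?_⟩
  · rw [hT, ← mul_kronecker_mul, hU, hV, one_kronecker_one]
  -- The coefficients `c₀`, `c₁`, `c₂`, `c₃` belong to `I ⊗ I`, `I ⊗ J`, `J ⊗ I`, `J ⊗ J`: sharing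
  -- the first index leaves the second free, so `c₁` carries the eigenvalue of the second factor.
  · have hd : (diagonal fun p : Fin m × Fin n => c₀ + c₁ * f p.2 + c₂ * e p.1 +
        c₃ * (e p.1 * f p.2)) = c₀ • (diagonal (fun _ => 1) ⊗ₖ diagonal (fun _ => 1)) +
          c₁ • (diagonal (fun _ => 1) ⊗ₖ diagonal f) + c₂ • (diagonal e ⊗ₖ diagonal (fun _ => 1)) +
          c₃ • (diagonal e ⊗ₖ diagonal f) := by
      simp only [diagonal_kronecker_diagonal]
      ext p q
      by_cases h : p = q <;> simp [h]
    change _ = (U ⊗ₖ V) * (diagonal fun p : Fin m × Fin n => c₀ + c₁ * f p.2 + c₂ * e p.1 +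
        c₃ * (e p.1 * f p.2)) * (U ⊗ₖ V)ᵀ
    rw [hd]
    simp only [Matrix.mul_add, Matrix.add_mul, Matrix.mul_smul, Matrix.smul_mul, hc]
    simp only [← hJU, ← hJV, diagonal_one, Matrix.mul_one, hU, hV]
    ext p q
    simp [Matrix.one_apply, Prod.ext_iff, ite_and]

end Kronecker

/-! ### Counting index pairs for each eigenvalue. -/

section Multiplicities

/-- The index of the eigenvalue attached to the pair `p` of indices of eigenvectors of the all-ones
matrices. -/
def eigenvalueIndex {m n : ℕ} (i₀ : Fin m) (j₀ : Fin n) (p : Fin m × Fin n) : Fin 4 :=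
  if p.1 = i₀ then if p.2 = j₀ then 3 else 1 else if p.2 = j₀ then 2 else 0

theorem card_eigenvalueIndex {m n : ℕ} (i₀ : Fin m) (j₀ : Fin n) (k : Fin 4) :
    ({p | eigenvalueIndex i₀ j₀ p = k} : Finset (Fin m × Fin n)).card =
      ![(m - 1) * (n - 1), n - 1, m - 1, 1] k := by
  have hm : (univ.erase i₀).card = m - 1 := by simp
  have hn : (univ.erase j₀).card = n - 1 := by simp
  fin_cases k
  · have : ({p | eigenvalueIndex i₀ j₀ p = 0} : Finset (Fin m × Fin n)) =
        univ.erase i₀ ×ˢ univ.erase j₀ := by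
      ext p
      rw [mem_filter]
      simp only [eigenvalueIndex, mem_univ, true_and, mem_product, mem_erase, and_true]
      split_ifs <;> simp_all
    change ({p | eigenvalueIndex i₀ j₀ p = 0} : Finset (Fin m × Fin n)).card = (m - 1) * (n - 1)
    rw [this, card_product, hm, hn]
  · have : ({p | eigenvalueIndex i₀ j₀ p = 1} : Finset (Fin m × Fin n)) =
        {i₀} ×ˢ univ.erase j₀ := by
      ext p
      rw [mem_filter]
      simp only [eigenvalueIndex, mem_univ, true_and, mem_product, mem_erase, and_true,
        mem_singleton]
      split_ifs <;> simp_all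
    change ({p | eigenvalueIndex i₀ j₀ p = 1} : Finset (Fin m × Fin n)).card = n - 1
    rw [this, card_product, hn, card_singleton, one_mul]
  · have : ({p | eigenvalueIndex i₀ j₀ p = 2} : Finset (Fin m × Fin n)) =
        univ.erase i₀ ×ˢ {j₀} := by
      ext p
      rw [mem_filter]
      simp only [eigenvalueIndex, mem_univ, true_and, mem_product, mem_erase, and_true,
        mem_singleton]
      split_ifs <;> simp_all
    change ({p | eigenvalueIndex i₀ j₀ p = 2} : Finset (Fin m × Fin n)).card = m - 1
    rw [this, card_product, hm, card_singleton, mul_one]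
  · have : ({p | eigenvalueIndex i₀ j₀ p = 3} : Finset (Fin m × Fin n)) = ({i₀} : Finset (Fin m)) ×ˢ ({j₀} : Finset (Fin n)) := by
      ext p
      rw [mem_filter]
      simp only [eigenvalueIndex, mem_univ, true_and, mem_product, mem_singleton]
      split_ifs <;> simp_all
    change ({p | eigenvalueIndex i₀ j₀ p = 3} : Finset (Fin m × Fin n)).card = 1
    rw [this, card_product, card_singleton, card_singleton]

theorem prod_eigenvalueIndex {M : Type*} [CommMonoid M] {m n : ℕ} (i₀ : Fin m) (j₀ : Fin n)
    (g : Fin 4 → M) :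
    ∏ p, g (eigenvalueIndex i₀ j₀ p) = ∏ k, g k ^ ![(m - 1) * (n - 1), n - 1, m - 1, 1] k := by
  rw [← Finset.prod_fiberwise' univ (eigenvalueIndex i₀ j₀) g]
  refine Finset.prod_congr rfl fun k _ => ?_
  rw [Finset.prod_const, card_eigenvalueIndex]

theorem sum_eigenvalueIndex {m n : ℕ} (i₀ : Fin m) (j₀ : Fin n) (g : Fin 4 → ℕ) :
    ∑ p, g (eigenvalueIndex i₀ j₀ p) = ∑ k, ![(m - 1) * (n - 1), n - 1, m - 1, 1] k * g k := by
  rw [← Finset.sum_fiberwise' univ (eigenvalueIndex i₀ j₀) g]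
  refine Finset.sum_congr rfl fun k _ => ?_
  rw [Finset.sum_const, card_eigenvalueIndex, smul_eq_mul]

end Multiplicities

/-! ### Eigenvalues, their signs, and the theorem. -/

/-- The eigenvalues of the Hessian of the Kirchhoff polynomial of `K_{m,n}`. -/
noncomputable def hessianEigenvalue (m n : ℕ) : Fin 4 → ℝ :=
  ![-2 * (m : ℝ) ^ ((n : ℤ) - 2) * (n : ℝ) ^ ((m : ℤ) - 2),
    -((m : ℝ) ^ ((n : ℤ) - 2) * (n : ℝ) ^ ((m : ℤ) - 1)),
    -((m : ℝ) ^ ((n : ℤ) - 1) * (n : ℝ) ^ ((m : ℤ) - 2)),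
    (m : ℝ) ^ ((n : ℤ) - 2) * (n : ℝ) ^ ((m : ℤ) - 2) * ((m : ℝ) + n - 1) * ((m : ℝ) + n - 2)]

/-- The bound `hmn` enters through the factor `m + n - 2` of the last value, which would vanish for
a single edge. -/
theorem hessianEigenvalue_pos_iff {m n : ℕ} (hm : 1 ≤ m) (hn : 1 ≤ n) (hmn : 3 ≤ m + n)
    (k : Fin 4) : 0 < hessianEigenvalue m n k ↔ k = 3 := by
  have hm0 : (0 : ℝ) < m := by positivity
  have hn0 : (0 : ℝ) < n := by positivity
  have h3 : (3 : ℝ) ≤ m + n := by exact_mod_cast hmn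
  have ha : ∀ z : ℤ, (0 : ℝ) < (m : ℝ) ^ z := fun z => zpow_pos hm0 z
  have hb : ∀ z : ℤ, (0 : ℝ) < (n : ℝ) ^ z := fun z => zpow_pos hn0 z
  have hab := fun z w => mul_pos (ha z) (hb w)
  fin_cases k
  · simp [hessianEigenvalue, mul_assoc, (hab _ _).le]
  · simp [hessianEigenvalue, (hab _ _).le]
  · simp [hessianEigenvalue, (hab _ _).le]
  · simpa [hessianEigenvalue] using
      mul_pos (mul_pos (hab _ _) (by linarith : (0 : ℝ) < m + n - 1))
        (by linarith : (0 : ℝ) < m + n - 2)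

theorem hessianEigenvalue_neg_iff {m n : ℕ} (hm : 1 ≤ m) (hn : 1 ≤ n) (hmn : 3 ≤ m + n)
    (k : Fin 4) : hessianEigenvalue m n k < 0 ↔ k ≠ 3 := by
  have hm0 : (0 : ℝ) < m := by positivity
  have hn0 : (0 : ℝ) < n := by positivity
  have h3 : (3 : ℝ) ≤ m + n := by exact_mod_cast hmn
  have ha : ∀ z : ℤ, (0 : ℝ) < (m : ℝ) ^ z := fun z => zpow_pos hm0 z
  have hb : ∀ z : ℤ, (0 : ℝ) < (n : ℝ) ^ z := fun z => zpow_pos hn0 z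
  have hab := fun z w => mul_pos (ha z) (hb w)
  fin_cases k
  · simp [hessianEigenvalue, mul_assoc, hab]
  · simp [hessianEigenvalue, hab]
  · simp [hessianEigenvalue, hab]
  · simpa using ((hessianEigenvalue_pos_iff hm hn hmn 3).2 rfl).le

theorem exists_orthogonal_conj_hessianAtOne {m n : ℕ} (hm : 1 ≤ m) (hn : 1 ≤ n) :
    ∃ (U : Matrix (completeBipartiteGraph (Fin m) (Fin n)).edgeSet
        (completeBipartiteGraph (Fin m) (Fin n)).edgeSet ℝ) (i₀ : Fin m) (j₀ : Fin n),
      U * Uᵀ = 1 ∧ hessianAtOne (completeBipartiteGraph (Fin m) (Fin n)) =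
        U * diagonal (fun e => hessianEigenvalue m n
          (eigenvalueIndex i₀ j₀ ((completeBipartiteEdgeEquiv _ _).symm e))) * Uᵀ := by
  obtain ⟨U, i₀, j₀, hU, h⟩ := exists_orthogonal_conj_prod m n hm hn
  let e := completeBipartiteEdgeEquiv (Fin m) (Fin n)
  have hm0 : (m : ℝ) ≠ 0 := by positivity
  have hn0 : (n : ℝ) ≠ 0 := by positivity
  have hm1 : (m : ℝ) ^ ((n : ℤ) - 1) = (m : ℝ) ^ (n - 1) := by
    rw [← zpow_natCast, Nat.cast_sub hn, Nat.cast_one]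
  have hn1 : (n : ℝ) ^ ((m : ℤ) - 1) = (n : ℝ) ^ (m - 1) := by
    rw [← zpow_natCast, Nat.cast_sub hm, Nat.cast_one]
  -- The exponent is `-1` when `n = 1`, hence integer powers and a division by `m`.
  have hm2 : (m : ℝ) ^ ((n : ℤ) - 2) = (m : ℝ) ^ (n - 1) / m := by
    rw [← hm1, div_eq_mul_inv, ← zpow_sub_one₀ hm0]
    congr 1; ring
  have hn2 : (n : ℝ) ^ ((m : ℤ) - 2) = (n : ℝ) ^ (m - 1) / n := by
    rw [← hn1, div_eq_mul_inv, ← zpow_sub_one₀ hn0]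
    congr 1; ring
  set τ : ℝ := (m : ℝ) ^ (n - 1) * (n : ℝ) ^ (m - 1) with hτ
  have hH : (hessianAtOne (completeBipartiteGraph (Fin m) (Fin n))).submatrix e e =
      U * diagonal (fun p => hessianEigenvalue m n (eigenvalueIndex i₀ j₀ p)) * Uᵀ := by
    -- With `x`, `y` the indicators of a shared left, right endpoint, the transfer current is `(m x
    -- + n y - 1) / (m n)`. Subtracting its square from the squared diagonal value `((m + n - 1) /
    -- (m n)) ^ 2`, with `x² = x` and `y² = y`, gives these coefficients of `x y`, `x`, `y` and `1`.
    have h' := h (-(τ * (2 / (m * n)))) (-(τ * ((m - 2) / (m * n ^ 2))))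
      (-(τ * ((n - 2) / (m ^ 2 * n)))) (τ * (((m + n - 1) ^ 2 - 1) / (m * n) ^ 2))
    refine Eq.trans ?_ (h'.trans ?_)
    · ext p q
      rw [submatrix_apply, hessianAtOne_completeBipartite m n hm hn]
      simp only [transferCurrent, of_apply, Prod.ext_iff, ite_and, if_true, eq_comm (a := q.1),
        eq_comm (a := q.2)]
      split_ifs <;> field_simp <;> ring
    · refine congrArg (fun d => U * diagonal d * Uᵀ) (funext fun p => ?_)
      simp only [hessianEigenvalue, eigenvalueIndex, hm1, hn1, hm2, hn2]
      split_ifs <;> simp [hτ] <;> field_simp <;> ring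
  refine ⟨U.submatrix e.symm e.symm, i₀, j₀, ?_, ?_⟩
  · rw [transpose_submatrix, submatrix_mul_equiv, hU, submatrix_one_equiv]
  · have hd : (diagonal fun x => hessianEigenvalue m n (eigenvalueIndex i₀ j₀ (e.symm x))) =
        (diagonal fun p => hessianEigenvalue m n (eigenvalueIndex i₀ j₀ p)).submatrix
          e.symm e.symm := by
      rw [submatrix_diagonal_equiv]
      rfl
    change _ = _ * (diagonal fun x => hessianEigenvalue m n
      (eigenvalueIndex i₀ j₀ (e.symm x))) * _
    rw [hd, transpose_submatrix, submatrix_mul_equiv, submatrix_mul_equiv, ← hH,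
      submatrix_submatrix]
    simp

theorem mainTheorem3 (m n : ℕ) (hm : 1 ≤ m) (hn : 1 ≤ n) (hmn : 3 ≤ m + n)
    (H : Matrix (completeBipartiteGraph (Fin m) (Fin n)).edgeSet
        (completeBipartiteGraph (Fin m) (Fin n)).edgeSet ℝ)
    (hH : H = SpanningTreeHessian.hessianAtOne (completeBipartiteGraph (Fin m) (Fin n)))
    -- the four eigenvalues
    (ev : Fin 4 → ℝ)
    (hev : ev =
      ![-2 * (m : ℝ) ^ ((n : ℤ) - 2) * (n : ℝ) ^ ((m : ℤ) - 2),
        -((m : ℝ) ^ ((n : ℤ) - 2) * (n : ℝ) ^ ((m : ℤ) - 1)),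
        -((m : ℝ) ^ ((n : ℤ) - 1) * (n : ℝ) ^ ((m : ℤ) - 2)),
        (m : ℝ) ^ ((n : ℤ) - 2) * (n : ℝ) ^ ((m : ℤ) - 2) *
          ((m : ℝ) + n - 1) * ((m : ℝ) + n - 2)])
    -- their multiplicities
    (mult : Fin 4 → ℕ)
    (hmult : mult = ![(m - 1) * (n - 1), n - 1, m - 1, 1]) :
    -- algebraic multiplicities
    H.charpoly = ∏ k, (Polynomial.X - Polynomial.C (ev k)) ^ mult k ∧
    -- dimensions of the eigenspaces; the contributions of coinciding eigenvalues add up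
    (∀ μ : ℝ, Module.finrank ℝ (Module.End.eigenspace (Matrix.toLin' H) μ) =
      ∑ k, if ev k = μ then mult k else 0) ∧
    -- Lorentzian signature
    sigPos (Matrix.toQuadraticForm' H) = 1 ∧
    sigNeg (Matrix.toQuadraticForm' H) = m * n - 1 := by
  obtain ⟨U, i₀, j₀, hU, hD⟩ := exists_orthogonal_conj_hessianAtOne hm hn
  rw [← hH] at hD
  change ev = hessianEigenvalue m n at hev
  rw [← hev] at hD
  let e := completeBipartiteEdgeEquiv (Fin m) (Fin n)
  have hQ := equivalent_weightedSumSquares_of_orthogonal_conj hU hD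
  -- The only positive weight sits at the edge pairing the two all-ones eigenvectors.
  have h3 : ∀ x, eigenvalueIndex i₀ j₀ (e.symm x) = 3 ↔ x = e (i₀, j₀) := by
    intro x
    rw [← e.symm_apply_eq]
    simp only [eigenvalueIndex, Prod.ext_iff]
    split_ifs <;> simp_all
  refine ⟨?_, fun μ => ?_, ?_, ?_⟩
  · rw [charpoly_of_orthogonal_conj hU hD, hmult, ← prod_eigenvalueIndex i₀ j₀]
    exact e.symm.prod_comp fun p => Polynomial.X - Polynomial.C (ev (eigenvalueIndex i₀ j₀ p))
  · rw [finrank_eigenspace_of_orthogonal_conj hU hD, Fintype.card_subtype, Finset.card_filter,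
      e.symm.sum_comp fun p => if ev (eigenvalueIndex i₀ j₀ p) = μ then 1 else 0,
      sum_eigenvalueIndex i₀ j₀ fun k => if ev k = μ then 1 else 0, hmult]
    simp
  · rw [QuadraticForm.sigPos_of_equiv_weightedSumSquares hQ]
    simp only [hev, hessianEigenvalue_pos_iff hm hn hmn]
    change {x | eigenvalueIndex i₀ j₀ (e.symm x) = 3}.ncard = 1
    simp only [h3, Set.ofPred_eq_eq_singleton, Set.ncard_singleton]
  · rw [QuadraticForm.sigNeg_of_equiv_weightedSumSquares hQ]
    simp only [hev, hessianEigenvalue_neg_iff hm hn hmn]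
    change {x | ¬ eigenvalueIndex i₀ j₀ (e.symm x) = 3}.ncard = m * n - 1
    have : {x | ¬ eigenvalueIndex i₀ j₀ (e.symm x) = 3} = {e (i₀, j₀)}ᶜ := by
      ext x
      simp [h3]
    rw [this, Set.ncard_compl, Set.ncard_singleton, Nat.card_congr e.symm]
    simp
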